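/- Let $S$ be a measurable space and $P_x(dy)$ a Markov (probability) transition kernel on $S$; write $\mathbb P_x(n,\cdot)$ for the $n$-step transition probabilities of the homogeneous Markov chain with kernel $P$, and let $\mu$ be a stationary probability measure, $\mu P=\mu$. For $x=(x^1,x^2)\in S^2:=S\times S$ put $$\kappa(x)=\int\Big(\frac{dP_{x^2}}{dP_{x^1}}(y)\wedge 1\Big)P_{x^1}(dy),\qquad \Lambda_x=\tfrac12(P_{x^1}+P_{x^2}),\qquad p_i=\frac{dP_{x^i}}{d\Lambda_x}\quad(i=1,2),$$ where $dP_{x^2}/dP_{x^1}$ is the density of the absolutely continuous component. Let $\eta^1_1,\eta^2_1$ be independent under $\mathbb P_x$; if $\kappa(x)<1$, let $\eta^i_1$ have density $(p_i-p_1\wedge p_2)/(1-\kappa(x))$ with respect to $\Lambda_x$, and if $\kappa(x)=1$ let both have the law $P_{x^1}$. This is the one-step law of the pair of chains in the Vaserstein-type Markov coupling, given that they do not couple at this step; coupling occurs at the step with probability $\kappa(x)$. Assume that $\kappa(x)$ and the laws of $\eta^1_1,\eta^2_1$ depend measurably on $x\in S^2$ with the product $\sigma$-algebra (which is automatic if the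 $\sigma$-algebra of $S$ is countably generated). On the Banach space of bounded measurable functions on $S^2$ with the supremum norm define the bounded operator $$Vh(x)=(1-\kappa(x))\,\mathbb E_x h(\eta^1_1,\eta^2_1),$$ and let $r(V)$ be its spectral radius (on complex-valued functions). Let $\|\cdot\|_{TV}$ denote the total variation norm of signed measures, $\mathbf 1$ the constant function $1$ on $S^2$, and $\ln 0=-\infty$. Theorem. For every $x^1\in S$, $$\limsup_{n\to\infty}\frac1n\ln\|\mathbb P_{x^1}(n,\cdot)-\mu\|_{TV}\ \le\ \limsup_{n\to\infty}\frac1n\ln\int 2\,V^n\mathbf 1(x^1,x^2)\,\mu(dx^2)\ \le\ \ln r(V).$$ -/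

import Mathlib

open MeasureTheory ProbabilityTheory Filter
open scoped ENNReal

namespace MarkovCoupling

noncomputable section

/-! ### The overlap coefficient and the transition law of the pair before coupling -/

section Laws

variable {S : Type*} [MeasurableSpace S]

/-- `κ(x¹, x²) = ∫ (dP_{x²}/dP_{x¹} ∧ 1) dP_{x¹}`, where the derivative is the density of the
absolutely continuous component. -/
def overlap (P : Kernel S S) (x : S × S) : ℝ≥0∞ :=
  ∫⁻ y, min ((P x.2).rnDeriv (P x.1) y) 1 ∂(P x.1)

/-- The reference measure `Λ_{x¹,x²} = (P_{x¹} + P_{x²}) / 2`. -/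
def refMeasure (P : Kernel S S) (x : S × S) : Measure S :=
  (2⁻¹ : ℝ≥0∞) • (P x.1 + P x.2)

/-- The density `p(x¹, ·)` of `P_{x¹}` with respect to `Λ_{x¹,x²}`. -/
def density₁ (P : Kernel S S) (x : S × S) : S → ℝ≥0∞ :=
  (P x.1).rnDeriv (refMeasure P x)

/-- The density `p(x², ·)` of `P_{x²}` with respect to `Λ_{x¹,x²}`. -/
def density₂ (P : Kernel S S) (x : S × S) : S → ℝ≥0∞ :=
  (P x.2).rnDeriv (refMeasure P x)

open Classical in
/-- The law of `η¹₁` given `(η¹₀, η²₀) = x`: it has `Λ_x`-density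
`(p(x¹, u) - p(x¹, u) ∧ p(x², u)) / (1 - κ(x))` if `κ(x) < 1`, and is `P_{x¹}` if `κ(x) = 1`. -/
def residualLaw₁ (P : Kernel S S) (x : S × S) : Measure S :=
  if overlap P x = 1 then P x.1
  else (refMeasure P x).withDensity
    (fun u ↦ (density₁ P x u - min (density₁ P x u) (density₂ P x u)) / (1 - overlap P x))

open Classical in
/-- The law of `η²₁` given `(η¹₀, η²₀) = x`: it has `Λ_x`-density
`(p(x², u) - p(x¹, u) ∧ p(x², u)) / (1 - κ(x))` if `κ(x) < 1`, and is `P_{x¹}` if `κ(x) = 1`. -/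
def residualLaw₂ (P : Kernel S S) (x : S × S) : Measure S :=
  if overlap P x = 1 then P x.1
  else (refMeasure P x).withDensity
    (fun u ↦ (density₂ P x u - min (density₁ P x u) (density₂ P x u)) / (1 - overlap P x))

/-- Well-posedness of the coupling: the coefficient `κ(x¹, x²)` and the one-step laws of `η¹` and
`η²` depend measurably on the pair `(x¹, x²)`, so that `(η¹, η²)` has a transition kernel. This is
automatic if the σ-algebra of `S` is countably generated (`measurableCoupling` below). -/
structure MeasurableCoupling (P : Kernel S S) : Prop where
  overlap : Measurable (overlap P)
  law₁ : Measurable (residualLaw₁ P)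
  law₂ : Measurable (residualLaw₂ P)

instance isMarkovKernel_pow (P : Kernel S S) [IsMarkovKernel P] (n : ℕ) :
    IsMarkovKernel (P ^ n) := by
  induction n with
  | zero => rw [pow_zero]; exact inferInstanceAs (IsMarkovKernel Kernel.id)
  | succ n ih => rw [pow_succ]; exact inferInstanceAs (IsMarkovKernel ((P ^ n) ∘ₖ P))

variable (P : Kernel S S) (x : S × S)

lemma absolutelyContinuous₁ : P x.1 ≪ refMeasure P x := by
  refine Measure.AbsolutelyContinuous.mk fun s _ h ↦ ?_
  simp only [refMeasure, Measure.smul_apply, Measure.add_apply, smul_eq_mul, mul_eq_zero,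
    ENNReal.inv_eq_zero, ENNReal.ofNat_ne_top, false_or, add_eq_zero] at h
  exact h.1

lemma absolutelyContinuous₂ : P x.2 ≪ refMeasure P x := by
  refine Measure.AbsolutelyContinuous.mk fun s _ h ↦ ?_
  simp only [refMeasure, Measure.smul_apply, Measure.add_apply, smul_eq_mul, mul_eq_zero,
    ENNReal.inv_eq_zero, ENNReal.ofNat_ne_top, false_or, add_eq_zero] at h
  exact h.2

lemma measurable_density₁ : Measurable (density₁ P x) := Measure.measurable_rnDeriv _ _

lemma measurable_density₂ : Measurable (density₂ P x) := Measure.measurable_rnDeriv _ _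

variable [IsMarkovKernel P]

instance : IsFiniteMeasure (refMeasure P x) := by
  unfold refMeasure
  refine ⟨?_⟩
  simp only [Measure.smul_apply, Measure.add_apply, measure_univ, smul_eq_mul]
  finiteness

lemma overlap_eq_lintegral_min :
    overlap P x = ∫⁻ u, min (density₁ P x u) (density₂ P x u) ∂(refMeasure P x) := by
  have h1 : overlap P x
      = ∫⁻ u, min (density₂ P x u / density₁ P x u) 1 ∂(P x.1) := by
    refine lintegral_congr_ae ?_
    filter_upwards [Measure.rnDeriv_eq_div (absolutelyContinuous₂ P x)
      (absolutelyContinuous₁ P x)] with u hu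
    rw [hu]; rfl
  have hm : Measurable fun u ↦ min (density₂ P x u / density₁ P x u) 1 :=
    ((measurable_density₂ P x).div (measurable_density₁ P x)).min measurable_const
  rw [h1, ← lintegral_rnDeriv_mul (absolutelyContinuous₁ P x) hm.aemeasurable]
  refine lintegral_congr_ae ?_
  filter_upwards [Measure.rnDeriv_ne_top (P x.1) (refMeasure P x)] with u hu
  change density₁ P x u * _ = _
  change density₁ P x u ≠ ∞ at hu
  by_cases h0 : density₁ P x u = 0
  · simp [h0]
  · rw [mul_min_of_nonneg _ _ (zero_le), ENNReal.mul_div_cancel h0 hu, mul_one, min_comm]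

lemma overlap_le_one : overlap P x ≤ 1 := by
  refine (lintegral_mono fun y ↦ min_le_right _ _).trans ?_
  simp

lemma lintegral_residual {f g : S → ℝ≥0∞} (hf : Measurable f) (hg : Measurable g)
    (hf1 : ∫⁻ u, f u ∂(refMeasure P x) = 1)
    (hfg : ∫⁻ u, g u ∂(refMeasure P x) = overlap P x) (hle : ∀ u, g u ≤ f u)
    (hx : overlap P x ≠ 1) :
    IsProbabilityMeasure ((refMeasure P x).withDensity
      (fun u ↦ (f u - g u) / (1 - overlap P x))) := by
  have h1 := overlap_le_one P x
  have hpos : 1 - overlap P x ≠ 0 := by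
    simpa [tsub_eq_zero_iff_le] using lt_of_le_of_ne h1 hx
  refine ⟨?_⟩
  rw [withDensity_apply _ MeasurableSet.univ, setLIntegral_univ]
  simp_rw [div_eq_mul_inv]
  have hm : Measurable fun u ↦ f u - g u := hf.sub hg
  rw [lintegral_mul_const _ hm, lintegral_sub hg
    (by rw [hfg]; exact ne_top_of_le_ne_top ENNReal.one_ne_top h1)
    (Eventually.of_forall hle), hf1, hfg]
  exact ENNReal.mul_inv_cancel hpos (by finiteness)

instance : IsProbabilityMeasure (residualLaw₁ P x) := by
  unfold residualLaw₁
  split_ifs with hx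
  · infer_instance
  · refine lintegral_residual P x (measurable_density₁ P x)
      ((measurable_density₁ P x).min (measurable_density₂ P x)) ?_
      (overlap_eq_lintegral_min P x).symm (fun u ↦ min_le_left _ _) hx
    exact (Measure.lintegral_rnDeriv (absolutelyContinuous₁ P x)).trans measure_univ

instance : IsProbabilityMeasure (residualLaw₂ P x) := by
  unfold residualLaw₂
  split_ifs with hx
  · infer_instance
  · refine lintegral_residual P x (measurable_density₂ P x)
      ((measurable_density₁ P x).min (measurable_density₂ P x)) ?_
      (overlap_eq_lintegral_min P x).symm (fun u ↦ min_le_right _ _) hx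
    exact (Measure.lintegral_rnDeriv (absolutelyContinuous₂ P x)).trans measure_univ

/-- The transition kernel of the pair `(η¹, η²)` before coupling: given the current pair, the two
coordinates of the next pair are independent with the residual laws. -/
def residualKernel (P : Kernel S S) (hP : MeasurableCoupling P) :
    Kernel (S × S) (S × S) :=
  Kernel.prod ⟨residualLaw₁ P, hP.law₁⟩ ⟨residualLaw₂ P, hP.law₂⟩

instance (hP : MeasurableCoupling P) : IsMarkovKernel (residualKernel P hP) := by
  have h1 : IsMarkovKernel (⟨residualLaw₁ P, hP.law₁⟩ : Kernel (S × S) S) :=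
    ⟨fun x ↦ inferInstanceAs (IsProbabilityMeasure (residualLaw₁ P x))⟩
  have h2 : IsMarkovKernel (⟨residualLaw₂ P, hP.law₂⟩ : Kernel (S × S) S) :=
    ⟨fun x ↦ inferInstanceAs (IsProbabilityMeasure (residualLaw₂ P x))⟩
  unfold residualKernel
  infer_instance

/-- If the σ-algebra of `S` is countably generated, then the coupling is well-posed. -/
theorem measurableCoupling [MeasurableSpace.CountablyGenerated S] : MeasurableCoupling P := by
  let K₁ : Kernel (S × S) S := P.comap Prod.fst measurable_fst
  let K₂ : Kernel (S × S) S := P.comap Prod.snd measurable_snd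
  have hΛ : Measurable (refMeasure P) := by
    refine Measure.measurable_of_measurable_coe _ fun s hs ↦ ?_
    simp only [refMeasure, Measure.smul_apply, Measure.add_apply, smul_eq_mul]
    exact (((P.measurable_coe hs).comp measurable_fst).add
      ((P.measurable_coe hs).comp measurable_snd)).const_mul _
  let L : Kernel (S × S) S := ⟨refMeasure P, hΛ⟩
  have : IsFiniteKernel L := by
    refine ⟨⟨1, ENNReal.one_lt_top, fun x ↦ ?_⟩⟩
    change refMeasure P x Set.univ ≤ 1
    simp only [refMeasure, Measure.smul_apply, Measure.add_apply, measure_univ, smul_eq_mul]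
    rw [one_add_one_eq_two, ENNReal.inv_mul_cancel (by simp) (by simp)]
  have e₁ (x : S × S) : Kernel.rnDeriv K₁ L x =ᵐ[refMeasure P x] density₁ P x :=
    Kernel.rnDeriv_eq_rnDeriv_measure
  have e₂ (x : S × S) : Kernel.rnDeriv K₂ L x =ᵐ[refMeasure P x] density₂ P x :=
    Kernel.rnDeriv_eq_rnDeriv_measure
  have m₁ : Measurable fun z : (S × S) × S ↦ Kernel.rnDeriv K₁ L z.1 z.2 :=
    Kernel.measurable_rnDeriv K₁ L
  have m₂ : Measurable fun z : (S × S) × S ↦ Kernel.rnDeriv K₂ L z.1 z.2 :=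
    Kernel.measurable_rnDeriv K₂ L
  have hκ : Measurable (overlap P) := by
    have h := (m₁.min m₂).lintegral_kernel_prod_right' (κ := L)
    convert h using 2 with x
    rw [overlap_eq_lintegral_min]
    refine lintegral_congr_ae ?_
    filter_upwards [e₁ x, e₂ x] with u h1 h2
    rw [h1, h2]
  have hset : MeasurableSet {x | overlap P x = 1} := hκ (measurableSet_singleton 1)
  have aux (f g : S × S → S → ℝ≥0∞) (k : (S × S) × S → ℝ≥0∞) (hk : Measurable k)
      (hfg : ∀ x, k.curry x =ᵐ[refMeasure P x] fun u ↦ f x u - g x u) :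
      Measurable fun x ↦ (refMeasure P x).withDensity
        (fun u ↦ (f x u - g x u) / (1 - overlap P x)) := by
    refine Measure.measurable_of_measurable_coe _ fun s hs ↦ ?_
    have hc : Measurable fun z : (S × S) × S ↦ 1 - overlap P z.1 :=
      measurable_const.sub (hκ.comp measurable_fst)
    have h := ((hk.div hc).indicator (measurable_snd hs)).lintegral_kernel_prod_right' (κ := L)
    convert h using 2 with x
    rw [withDensity_apply _ hs, ← lintegral_indicator hs]
    refine lintegral_congr_ae ?_
    filter_upwards [hfg x] with u hu
    rw [Function.curry_apply] at hu
    by_cases hus : u ∈ s <;> simp [hus, hu]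
  refine ⟨hκ, Measurable.ite hset (P.measurable.comp measurable_fst) ?_,
    Measurable.ite hset (P.measurable.comp measurable_fst) ?_⟩
  · refine aux _ _ _ (m₁.sub (m₁.min m₂)) fun x ↦ ?_
    filter_upwards [e₁ x, e₂ x] with u h1 h2
    simp [h1, h2]
  · refine aux _ _ _ (m₂.sub (m₁.min m₂)) fun x ↦ ?_
    filter_upwards [e₁ x, e₂ x] with u h1 h2
    simp [h1, h2]

end Laws

/-! ### The coupling operator on bounded measurable functions -/

section Operator

/-- The space of bounded measurable functions `α → 𝕜` with the supremum norm. -/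
def BoundedMeasurable (α 𝕜 : Type*) [MeasurableSpace α] [RCLike 𝕜] :
    Submodule 𝕜 (lp (fun _ : α ↦ 𝕜) ∞) where
  carrier := {f | Measurable (f : α → 𝕜)}
  add_mem' {f g} hf hg := by
    simp only [Set.mem_ofPred_eq, lp.coeFn_add] at *
    exact hf.add hg
  zero_mem' := by
    simp only [Set.mem_ofPred_eq, lp.coeFn_zero]
    exact measurable_zero
  smul_mem' c f hf := by
    simp only [Set.mem_ofPred_eq, lp.coeFn_smul] at *
    exact hf.const_smul c

namespace BoundedMeasurable

variable {α 𝕜 : Type*} [MeasurableSpace α] [RCLike 𝕜]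

instance : CoeFun (BoundedMeasurable α 𝕜) fun _ ↦ α → 𝕜 := ⟨fun h ↦ (h : lp (fun _ : α ↦ 𝕜) ∞)⟩

/-- A bounded measurable function as an element of the space. -/
def mk (h : α → 𝕜) (hm : Measurable h) (C : ℝ) (hC : ∀ x, ‖h x‖ ≤ C) : BoundedMeasurable α 𝕜 :=
  ⟨⟨h, memℓp_infty ⟨C, by rintro _ ⟨x, rfl⟩; exact hC x⟩⟩, hm⟩

@[simp]
lemma mk_apply (h : α → 𝕜) (hm : Measurable h) (C : ℝ) (hC : ∀ x, ‖h x‖ ≤ C) (x : α) :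
    mk h hm C hC x = h x := rfl

lemma measurable (h : BoundedMeasurable α 𝕜) : Measurable h := h.2

lemma norm_apply_le (h : BoundedMeasurable α 𝕜) (x : α) : ‖h x‖ ≤ ‖h‖ :=
  lp.norm_apply_le_norm ENNReal.top_ne_zero (h : lp (fun _ : α ↦ 𝕜) ∞) x

lemma integrable (h : BoundedMeasurable α 𝕜) (ν : Measure α) [IsFiniteMeasure ν] :
    Integrable h ν :=
  Integrable.of_bound (measurable h).aestronglyMeasurable ‖h‖
    (Eventually.of_forall (norm_apply_le h))

/-- The constant function `1`. -/
def one (α 𝕜 : Type*) [MeasurableSpace α] [RCLike 𝕜] : BoundedMeasurable α 𝕜 :=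
  mk (fun _ ↦ 1) measurable_const 1 (by simp)

end BoundedMeasurable

variable {S : Type*} [MeasurableSpace S] (𝕜 : Type*) [RCLike 𝕜] (P : Kernel S S)
  (hP : MeasurableCoupling P)

/-- `(1 - κ(x)) * E_x h(η¹₁, η²₁)`. One step of the coupling started at the uncoupled pair `x`
couples with probability `κ(x)`, and otherwise moves to `(η¹₁, η²₁)`; so this is the expectation of
`h` at the next pair, taken over the event that the pair stays uncoupled. -/
def couplingFun (h : S × S → 𝕜) (x : S × S) : 𝕜 :=
  (((1 - overlap P x).toReal : ℝ) : 𝕜) * ∫ y, h y ∂(residualKernel P hP x)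

variable {𝕜} in
lemma measurable_couplingFun (h : BoundedMeasurable (S × S) 𝕜) :
    Measurable (couplingFun 𝕜 P hP h) := by
  refine Measurable.mul ?_ ?_
  · exact RCLike.measurable_ofReal.comp (measurable_const.sub hP.overlap).ennreal_toReal
  · exact (StronglyMeasurable.integral_kernel (κ := residualKernel P hP)
      (BoundedMeasurable.measurable h).stronglyMeasurable).measurable

variable [IsMarkovKernel P]

variable {𝕜} in
lemma norm_couplingFun_le (h : BoundedMeasurable (S × S) 𝕜) (x : S × S) :
    ‖couplingFun 𝕜 P hP h x‖ ≤ ‖h‖ := by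
  have h1 : ‖∫ y, h y ∂(residualKernel P hP x)‖ ≤ ‖h‖ := by
    simpa using norm_integral_le_of_norm_le_const (μ := residualKernel P hP x)
      (Eventually.of_forall (BoundedMeasurable.norm_apply_le h))
  have h2 : ‖(((1 - overlap P x).toReal : ℝ) : 𝕜)‖ ≤ 1 := by
    rw [RCLike.norm_ofReal, abs_of_nonneg ENNReal.toReal_nonneg]
    exact ENNReal.toReal_le_of_le_ofReal zero_le_one (by simp)
  unfold couplingFun
  rw [norm_mul]
  calc _ ≤ 1 * ‖h‖ := by gcongr
    _ = ‖h‖ := one_mul _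

/-- The coupling operator `V h(x) = (1 - κ(x)) * E_x h(η¹₁, η²₁)` as a bounded operator on the
Banach space of bounded measurable functions on `S × S`. -/
def couplingOperator : BoundedMeasurable (S × S) 𝕜 →L[𝕜] BoundedMeasurable (S × S) 𝕜 :=
  LinearMap.mkContinuous
    { toFun := fun h ↦ BoundedMeasurable.mk (couplingFun 𝕜 P hP h)
        (measurable_couplingFun P hP h) ‖h‖ (norm_couplingFun_le P hP h)
      map_add' := fun f g ↦ by
        ext x
        change couplingFun 𝕜 P hP (fun y ↦ f y + g y) x
          = couplingFun 𝕜 P hP f x + couplingFun 𝕜 P hP g x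
        simp only [couplingFun]
        rw [integral_add (BoundedMeasurable.integrable f _) (BoundedMeasurable.integrable g _), mul_add]
      map_smul' := fun c f ↦ by
        ext x
        change couplingFun 𝕜 P hP (fun y ↦ c * f y) x = c * couplingFun 𝕜 P hP f x
        simp only [couplingFun]
        rw [integral_const_mul, mul_left_comm] }
    1 (fun h ↦ by
      rw [one_mul]
      exact lp.norm_le_of_forall_le (norm_nonneg h) (norm_couplingFun_le P hP h))

/-- The spectral radius of `V`: the largest modulus of a point of the spectrum of `V` acting on
complex-valued bounded measurable functions. -/
def couplingSpectralRadius : ℝ≥0∞ := spectralRadius ℂ (couplingOperator ℂ P hP)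

end Operator

/-- The total variation norm `‖μ - ν‖_TV = |μ - ν|(S)` (at most `2` for probability measures). -/
def tvDist {S : Type*} [MeasurableSpace S] (μ ν : Measure S) [IsFiniteMeasure μ]
    [IsFiniteMeasure ν] : ℝ≥0∞ :=
  (μ.toSignedMeasure - ν.toSignedMeasure).totalVariation Set.univ

end

end MarkovCoupling

/-!
The two chains share, at each step, the measure with density `p₁ ∧ p₂` with respect to `Λ_x`:
`P_{xⁱ}` is this overlap measure, of mass `κ(x)`, plus `1 - κ(x)` times the residual law of `ηⁱ₁`.
Hence the overlap cancels in `∫ g dP_{x¹} - ∫ g dP_{x²}`, and what is left is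
`V ((y¹, y²) ↦ g y¹ - g y²) x` (`integral_sub_integral_eq_couplingFun`). With `g = P^n(·, A)` and the
positivity of `V`, induction on `n` gives `|P^n(x¹, A) - P^n(x², A)| ≤ V^n 1(x¹, x²)` for every
event `A` (`abs_real_pow_sub_le`). Integrating over the stationary law of `x²` replaces the second
term by `μ(A)`, and the total variation norm is at most twice the supremum over `A`
(`tvDist_pow_le`); this holds for every `n`, so it passes to the growth rates.

For the second inequality, `∫ 2 V^n 1 dμ ≤ 2 ‖V^n‖`, where `V` may be taken to act on complex
functions because it commutes with the inclusion of the real-valued ones. These form a Banach space,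
so Gelfand's formula gives `(2 ‖V^n‖)^(1/n) → r(V)`, and `log` is continuous on `[0, ∞]`
(`tendsto_log_norm_couplingOperator_pow`).
-/

/-! ### Total variation and the values of a signed measure -/

/-- A signed measure bounded by `c` on every measurable set has total variation at most `2 * c`:
the total variation is attained on the two halves of a Hahn decomposition. -/
lemma MeasureTheory.SignedMeasure.totalVariation_univ_le {α : Type*} [MeasurableSpace α]
    (s : SignedMeasure α) {c : ℝ} (h : ∀ A, MeasurableSet A → |s A| ≤ c) :
    s.totalVariation Set.univ ≤ ENNReal.ofReal (2 * c) := by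
  obtain ⟨i, hi, hpos, hneg, h1, h2⟩ := s.toJordanDecomposition_spec
  have hc : 0 ≤ c := (abs_nonneg _).trans (h ∅ MeasurableSet.empty)
  rw [SignedMeasure.totalVariation, Measure.add_apply, h1, h2, two_mul,
    ENNReal.ofReal_add hc hc]
  refine add_le_add ?_ ?_
  · rw [← ofReal_measureReal,
      s.toMeasureOfZeroLE_real_apply hpos hi MeasurableSet.univ, Set.inter_univ]
    exact ENNReal.ofReal_le_ofReal ((le_abs_self _).trans (h i hi))
  · rw [← ofReal_measureReal,
      s.toMeasureOfLEZero_real_apply hneg hi.compl MeasurableSet.univ, Set.inter_univ]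
    exact ENNReal.ofReal_le_ofReal ((neg_le_abs _).trans (h iᶜ hi.compl))

namespace MarkovCoupling

/-! ### Decomposition of one step into overlap and residual laws -/

variable {S : Type*} [MeasurableSpace S] (P : Kernel S S) [IsMarkovKernel P] (x : S × S)

/-- The part of the law of a step on which the two chains couple; it is common to `P_{x¹}` and
`P_{x²}`, and has mass `κ(x)`. -/
noncomputable def overlapMeasure (P : Kernel S S) (x : S × S) : Measure S :=
  (refMeasure P x).withDensity fun u ↦ min (density₁ P x u) (density₂ P x u)

instance : IsFiniteMeasure (overlapMeasure P x) := by
  refine isFiniteMeasure_withDensity ?_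
  rw [← overlap_eq_lintegral_min]
  exact ne_top_of_le_ne_top ENNReal.one_ne_top (overlap_le_one P x)

lemma withDensity_add_smul_div (ν : Measure S) {f g : S → ℝ≥0∞} (hg : Measurable g)
    (hle : ∀ u, g u ≤ f u) {c : ℝ≥0∞} (hc : c ≠ 0) (hc' : c ≠ ∞) :
    ν.withDensity g + c • ν.withDensity (fun u ↦ (f u - g u) / c) = ν.withDensity f := by
  rw [← withDensity_smul' _ _ hc', ← withDensity_add_left hg]
  congr 1
  ext u
  simp only [Pi.add_apply, Pi.smul_apply, smul_eq_mul]
  rw [ENNReal.mul_div_cancel hc hc', add_tsub_cancel_of_le (hle u)]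

lemma overlapMeasure_le₁ : overlapMeasure P x ≤ P x.1 := by
  conv_rhs => rw [← Measure.withDensity_rnDeriv_eq _ _ (absolutelyContinuous₁ P x)]
  exact withDensity_mono (Eventually.of_forall fun u ↦ min_le_left _ _)

lemma overlapMeasure_le₂ : overlapMeasure P x ≤ P x.2 := by
  conv_rhs => rw [← Measure.withDensity_rnDeriv_eq _ _ (absolutelyContinuous₂ P x)]
  exact withDensity_mono (Eventually.of_forall fun u ↦ min_le_right _ _)

lemma overlapMeasure_univ : overlapMeasure P x Set.univ = overlap P x := by
  rw [overlapMeasure, withDensity_apply _ MeasurableSet.univ, setLIntegral_univ,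
    overlap_eq_lintegral_min]

lemma eq_of_le_of_overlap_eq_one {ν : Measure S} [IsProbabilityMeasure ν]
    (hν : overlapMeasure P x ≤ ν) (hx : overlap P x = 1) : overlapMeasure P x = ν := by
  have : IsProbabilityMeasure (overlapMeasure P x) := ⟨by rw [overlapMeasure_univ, hx]⟩
  exact Measure.eq_of_le_of_isProbabilityMeasure hν

/-- One step of the first chain: couple with probability `κ(x)`, or else follow the residual
law. -/
lemma overlapMeasure_add_residualLaw₁ :
    overlapMeasure P x + (1 - overlap P x) • residualLaw₁ P x = P x.1 := by
  by_cases hx : overlap P x = 1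
  · simp [hx, eq_of_le_of_overlap_eq_one P x (overlapMeasure_le₁ P x) hx]
  · have hpos : 1 - overlap P x ≠ 0 := by
      simpa [tsub_eq_zero_iff_le] using lt_of_le_of_ne (overlap_le_one P x) hx
    rw [residualLaw₁, if_neg hx, overlapMeasure, withDensity_add_smul_div _
      ((measurable_density₁ P x).min (measurable_density₂ P x)) (fun u ↦ min_le_left _ _) hpos
      (by finiteness)]
    exact Measure.withDensity_rnDeriv_eq _ _ (absolutelyContinuous₁ P x)

/-- One step of the second chain: couple with probability `κ(x)`, or else follow the residual
law. If `κ(x) = 1`, the residual law is given the weight `0`, so it may be that of `P_{x¹}`. -/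
lemma overlapMeasure_add_residualLaw₂ :
    overlapMeasure P x + (1 - overlap P x) • residualLaw₂ P x = P x.2 := by
  by_cases hx : overlap P x = 1
  · simp [hx, eq_of_le_of_overlap_eq_one P x (overlapMeasure_le₂ P x) hx]
  · have hpos : 1 - overlap P x ≠ 0 := by
      simpa [tsub_eq_zero_iff_le] using lt_of_le_of_ne (overlap_le_one P x) hx
    rw [residualLaw₂, if_neg hx, overlapMeasure, withDensity_add_smul_div _
      ((measurable_density₁ P x).min (measurable_density₂ P x)) (fun u ↦ min_le_right _ _) hpos
      (by finiteness)]
    exact Measure.withDensity_rnDeriv_eq _ _ (absolutelyContinuous₂ P x)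

/-! ### The coupling inequality -/

variable (hP : MeasurableCoupling P)

lemma residualKernel_apply :
    residualKernel P hP x = (residualLaw₁ P x).prod (residualLaw₂ P x) := by
  have h1 : IsMarkovKernel (⟨residualLaw₁ P, hP.law₁⟩ : Kernel (S × S) S) :=
    ⟨fun x ↦ inferInstanceAs (IsProbabilityMeasure (residualLaw₁ P x))⟩
  have h2 : IsMarkovKernel (⟨residualLaw₂ P, hP.law₂⟩ : Kernel (S × S) S) :=
    ⟨fun x ↦ inferInstanceAs (IsProbabilityMeasure (residualLaw₂ P x))⟩
  exact Kernel.prod_apply _ _ x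

/-- The coupling mechanism: the overlap cancels in `P_{x¹} g - P_{x²} g`, and what remains is the
coupling operator applied to `(y¹, y²) ↦ g y¹ - g y²`. -/
lemma integral_sub_integral_eq_couplingFun {g : S → ℝ} (hg : Measurable g) {C : ℝ}
    (hC : ∀ y, ‖g y‖ ≤ C) :
    ∫ y, g y ∂(P x.1) - ∫ y, g y ∂(P x.2) = couplingFun ℝ P hP (fun y ↦ g y.1 - g y.2) x := by
  have hi (ν : Measure S) [IsFiniteMeasure ν] : Integrable g ν :=
    Integrable.of_bound hg.aestronglyMeasurable C (Eventually.of_forall hC)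
  have hc : 1 - overlap P x ≠ ∞ := by finiteness
  conv_lhs => rw [← overlapMeasure_add_residualLaw₁, ← overlapMeasure_add_residualLaw₂]
  rw [integral_add_measure (hi _) ((hi _).smul_measure hc),
    integral_add_measure (hi _) ((hi _).smul_measure hc), integral_smul_measure,
    integral_smul_measure, couplingFun, residualKernel_apply,
    integral_sub ((hi _).comp_fst _) ((hi _).comp_snd _), integral_fun_fst, integral_fun_snd]
  simp only [measureReal_def, measure_univ, smul_eq_mul, ENNReal.toReal_one, RCLike.ofReal_real_eq_id,
    id_eq]
  ring

/-! The next two instances are shortcuts for a slow instance search through the `lp` space. They are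
local: used globally, they would enter the powers of `V` in the theorem, which are formed with the
instances of the full search, equal to these by unfolding but not syntactically. -/

noncomputable local instance (α 𝕜 : Type*) [MeasurableSpace α] [RCLike 𝕜] :
    NormedRing (BoundedMeasurable α 𝕜 →L[𝕜] BoundedMeasurable α 𝕜) :=
  ContinuousLinearMap.toNormedRing

noncomputable local instance (α 𝕜 : Type*) [MeasurableSpace α] [RCLike 𝕜] :
    Monoid (BoundedMeasurable α 𝕜 →L[𝕜] BoundedMeasurable α 𝕜) :=
  ContinuousLinearMap.monoidWithZero.toMonoid

lemma couplingOperator_pow_succ_apply (𝕜 : Type*) [RCLike 𝕜] (n : ℕ)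
    (h : BoundedMeasurable (S × S) 𝕜) :
    ((couplingOperator 𝕜 P hP ^ (n + 1)) h) x
      = couplingFun 𝕜 P hP ((couplingOperator 𝕜 P hP ^ n) h) x := by
  rw [pow_succ']
  rfl

lemma real_pow_succ_apply (n : ℕ) (x : S) {A : Set S} (hA : MeasurableSet A) :
    ((P ^ (n + 1)) x).real A = ∫ y, ((P ^ n) y).real A ∂(P x) := by
  have h : (P ^ (n + 1)) x A = ∫⁻ y, (P ^ n) y A ∂(P x) := by
    rw [pow_succ]
    exact Kernel.comp_apply' _ _ _ hA
  rw [measureReal_def, h, ← integral_toReal ((P ^ n).measurable_coe hA).aemeasurable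
    (Eventually.of_forall fun y ↦ measure_lt_top _ _)]
  rfl

lemma measurable_real_pow (P : Kernel S S) (n : ℕ) {A : Set S} (hA : MeasurableSet A) :
    Measurable fun y ↦ ((P ^ n) y).real A :=
  ((P ^ n).measurable_coe hA).ennreal_toReal

lemma norm_real_pow_le (n : ℕ) (A : Set S) (y : S) : ‖((P ^ n) y).real A‖ ≤ 1 := by
  rw [Real.norm_of_nonneg measureReal_nonneg]
  exact measureReal_le_one

/-- The `n`-step laws from `x¹` and `x²` differ on any event by at most `V^n 1(x)`, the probability
that the pair is still uncoupled at time `n`. -/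
lemma abs_real_pow_sub_le (n : ℕ) {A : Set S} (hA : MeasurableSet A) :
    |((P ^ n) x.1).real A - ((P ^ n) x.2).real A|
      ≤ ((couplingOperator ℝ P hP ^ n) (BoundedMeasurable.one (S × S) ℝ)) x := by
  induction n generalizing x with
  | zero =>
    have h (y : S) : ((P ^ 0) y).real A ∈ Set.Icc (0 : ℝ) 1 :=
      ⟨measureReal_nonneg, measureReal_le_one⟩
    change _ ≤ (1 : ℝ)
    rw [abs_le]
    constructor <;> linarith [(h x.1).1, (h x.1).2, (h x.2).1, (h x.2).2]
  | succ n ih =>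
    rw [real_pow_succ_apply P n _ hA, real_pow_succ_apply P n _ hA,
      integral_sub_integral_eq_couplingFun P x hP (measurable_real_pow P n hA)
        (norm_real_pow_le P n A),
      couplingOperator_pow_succ_apply, couplingFun, couplingFun, abs_mul, RCLike.ofReal_real_eq_id,
      id_eq, abs_of_nonneg ENNReal.toReal_nonneg]
    refine mul_le_mul_of_nonneg_left ?_ ENNReal.toReal_nonneg
    exact norm_integral_le_of_norm_le (BoundedMeasurable.integrable _ _) 
      (Eventually.of_forall fun y ↦ (Real.norm_eq_abs _).trans_le (ih y))

lemma invariant_pow (P : Kernel S S) {μ : Measure S} (hμ : Kernel.Invariant P μ) (n : ℕ) :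
    Kernel.Invariant (P ^ n) μ := by
  induction n with
  | zero => exact Measure.bind_dirac
  | succ n ih => rw [pow_succ]; exact ih.comp hμ

lemma integrable_section (h : BoundedMeasurable (S × S) ℝ) (x₁ : S) (μ : Measure S)
    [IsFiniteMeasure μ] : Integrable (fun x₂ ↦ h (x₁, x₂)) μ :=
  Integrable.of_bound
    ((BoundedMeasurable.measurable h).comp measurable_prodMk_left).aestronglyMeasurable ‖h‖
    (Eventually.of_forall fun x₂ ↦ BoundedMeasurable.norm_apply_le h (x₁, x₂))

/-- The coupling inequality: averaging the bound for two starting points over the stationary law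
of the second one. -/
lemma tvDist_pow_le {μ : Measure S} [IsProbabilityMeasure μ] (hμ : Kernel.Invariant P μ)
    (x₁ : S) (n : ℕ) :
    tvDist ((P ^ n) x₁) μ ≤ ENNReal.ofReal (∫ x₂, 2 *
      ((couplingOperator ℝ P hP ^ n) (BoundedMeasurable.one (S × S) ℝ)) (x₁, x₂) ∂μ) := by
  rw [integral_const_mul]
  refine SignedMeasure.totalVariation_univ_le _ fun A hA ↦ ?_
  have hi : Integrable (fun y ↦ ((P ^ n) y).real A) μ :=
    Integrable.of_bound (measurable_real_pow P n hA).aestronglyMeasurable 1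
      (Eventually.of_forall (norm_real_pow_le P n A))
  have hμA : μ.real A = ∫ y, ((P ^ n) y).real A ∂μ := by
    rw [measureReal_def]
    conv_lhs => rw [← (invariant_pow P hμ n).def]
    rw [Measure.bind_apply hA (P ^ n).aemeasurable,
      ← integral_toReal ((P ^ n).measurable_coe hA).aemeasurable
        (Eventually.of_forall fun y ↦ measure_lt_top _ _)]
    rfl
  have hconst : ((P ^ n) x₁).real A = ∫ _, ((P ^ n) x₁).real A ∂μ := by simp
  rw [sub_apply, Measure.toSignedMeasure_apply_measurable hA,
    Measure.toSignedMeasure_apply_measurable hA, hμA, hconst,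
    ← integral_sub (integrable_const _) hi]
  exact norm_integral_le_of_norm_le (integrable_section _ x₁ μ)
    (Eventually.of_forall fun x₂ ↦
      (Real.norm_eq_abs _).trans_le (abs_real_pow_sub_le P (x₁, x₂) hP n hA))

/-! ### The growth rate of the iterates and the spectral radius -/

/-- Uniform limits of measurable functions are measurable. -/
lemma isClosed_boundedMeasurable (α 𝕜 : Type*) [MeasurableSpace α] [RCLike 𝕜] :
    IsClosed (BoundedMeasurable α 𝕜 : Set (lp (fun _ : α ↦ 𝕜) ∞)) := by
  refine isClosed_of_closure_subset fun f hf ↦ ?_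
  obtain ⟨u, hu, hlim⟩ := mem_closure_iff_seq_limit.1 hf
  refine measurable_of_tendsto_metrizable hu (tendsto_pi_nhds.2 fun a ↦ ?_)
  rw [tendsto_iff_norm_sub_tendsto_zero] at hlim ⊢
  exact squeeze_zero (fun _ ↦ norm_nonneg _)
    (fun n ↦ lp.norm_apply_le_norm ENNReal.top_ne_zero (u n - f) a) hlim

instance (α 𝕜 : Type*) [MeasurableSpace α] [RCLike 𝕜] :
    CompleteSpace (BoundedMeasurable α 𝕜) :=
  (isClosed_boundedMeasurable α 𝕜).completeSpace_coe

lemma ofReal_couplingOperator_pow_one (n : ℕ) :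
    ((((couplingOperator ℝ P hP ^ n) (BoundedMeasurable.one (S × S) ℝ)) x : ℝ) : ℂ)
      = ((couplingOperator ℂ P hP ^ n) (BoundedMeasurable.one (S × S) ℂ)) x := by
  induction n generalizing x with
  | zero => exact Complex.ofReal_one
  | succ n ih =>
    rw [couplingOperator_pow_succ_apply, couplingOperator_pow_succ_apply, couplingFun, couplingFun]
    simp_rw [← ih]
    rw [integral_complex_ofReal]
    simp

lemma couplingOperator_pow_one_le (n : ℕ) :
    ((couplingOperator ℝ P hP ^ n) (BoundedMeasurable.one (S × S) ℝ)) x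
      ≤ ‖couplingOperator ℂ P hP ^ n‖ := by
  have h1 : ‖BoundedMeasurable.one (S × S) ℂ‖ ≤ 1 :=
    lp.norm_le_of_forall_le zero_le_one fun y ↦ (norm_one (α := ℂ)).le
  calc _ ≤ ‖((((couplingOperator ℝ P hP ^ n) (BoundedMeasurable.one (S × S) ℝ)) x : ℝ) : ℂ)‖ := by
        rw [Complex.norm_real]; exact le_abs_self _
    _ ≤ ‖(couplingOperator ℂ P hP ^ n) (BoundedMeasurable.one (S × S) ℂ)‖ := by
        rw [ofReal_couplingOperator_pow_one]
        exact BoundedMeasurable.norm_apply_le _ x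
    _ ≤ ‖couplingOperator ℂ P hP ^ n‖ * 1 := ContinuousLinearMap.le_opNorm_of_le _ h1
    _ = _ := mul_one _

lemma ofReal_integral_le (μ : Measure S) [IsProbabilityMeasure μ] (x₁ : S) (n : ℕ) :
    ENNReal.ofReal (∫ x₂, 2 *
      ((couplingOperator ℝ P hP ^ n) (BoundedMeasurable.one (S × S) ℝ)) (x₁, x₂) ∂μ)
      ≤ 2 * (‖couplingOperator ℂ P hP ^ n‖₊ : ℝ≥0∞) := by
  have h : ∫ x₂, 2 *
      ((couplingOperator ℝ P hP ^ n) (BoundedMeasurable.one (S × S) ℝ)) (x₁, x₂) ∂μ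
      ≤ ∫ _, 2 * ‖couplingOperator ℂ P hP ^ n‖ ∂μ := by
    refine integral_mono_of_nonneg (Eventually.of_forall fun x₂ ↦ ?_) (integrable_const _)
      (Eventually.of_forall fun x₂ ↦ ?_)
    · exact mul_nonneg zero_le_two
        ((abs_nonneg _).trans (abs_real_pow_sub_le P (x₁, x₂) hP n MeasurableSet.empty))
    · exact mul_le_mul_of_nonneg_left (couplingOperator_pow_one_le P (x₁, x₂) hP n) zero_le_two
  refine (ENNReal.ofReal_le_ofReal h).trans_eq ?_
  rw [integral_const, probReal_univ, one_smul, ENNReal.ofReal_mul zero_le_two,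
    ENNReal.ofReal_ofNat, ← enorm_eq_nnnorm, ofReal_norm]

/-- Gelfand's formula on the logarithmic scale, with a constant factor that does not affect the
growth rate. -/
lemma tendsto_log_norm_couplingOperator_pow :
    Tendsto (fun n : ℕ ↦ ((1 / (n : ℝ) : ℝ) : EReal) *
        ENNReal.log (2 * (‖couplingOperator ℂ P hP ^ n‖₊ : ℝ≥0∞))) atTop
      (nhds (ENNReal.log (couplingSpectralRadius P hP))) := by
  have h2 : Tendsto (fun n : ℕ ↦ (2 : ℝ≥0∞) ^ (1 / (n : ℝ))) atTop (nhds 1) := by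
    have h : Tendsto (fun n : ℕ ↦ ENNReal.ofReal (2 ^ (1 / (n : ℝ)))) atTop
        (nhds (ENNReal.ofReal (2 ^ (0 : ℝ)))) :=
      ENNReal.tendsto_ofReal
        (((Real.continuous_const_rpow two_ne_zero).tendsto 0).comp
          tendsto_one_div_atTop_nhds_zero_nat)
    rw [Real.rpow_zero, ENNReal.ofReal_one] at h
    refine h.congr fun n ↦ ?_
    rw [← ENNReal.ofReal_rpow_of_pos two_pos, ENNReal.ofReal_ofNat]
  have hV := spectrum.pow_nnnorm_pow_one_div_tendsto_nhds_spectralRadius (couplingOperator ℂ P hP)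
  have h := ENNReal.Tendsto.mul h2 (Or.inl one_ne_zero) hV (Or.inr ENNReal.one_ne_top)
  rw [one_mul] at h
  refine ((ENNReal.continuous_log.tendsto _).comp h).congr fun n ↦ ?_
  rw [Function.comp_apply, ← ENNReal.mul_rpow_of_nonneg _ _ (by positivity), ENNReal.log_rpow]

end MarkovCoupling

theorem theorem1 {S : Type*} [MeasurableSpace S] (P : Kernel S S) [IsMarkovKernel P]
    (hP : MarkovCoupling.MeasurableCoupling P)
    (μ : Measure S) [IsProbabilityMeasure μ] (hμ : Kernel.Invariant P μ) (x₁ : S) :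
    limsup (fun n : ℕ ↦ ((1 / (n : ℝ) : ℝ) : EReal) *
        ENNReal.log (MarkovCoupling.tvDist ((P ^ n) x₁) μ)) atTop
      ≤ limsup (fun n : ℕ ↦ ((1 / (n : ℝ) : ℝ) : EReal) *
        ENNReal.log (ENNReal.ofReal (∫ x₂, 2 *
          ((MarkovCoupling.couplingOperator ℝ P hP ^ n)
            (MarkovCoupling.BoundedMeasurable.one (S × S) ℝ)) (x₁, x₂) ∂μ))) atTop ∧
    limsup (fun n : ℕ ↦ ((1 / (n : ℝ) : ℝ) : EReal) *
        ENNReal.log (ENNReal.ofReal (∫ x₂, 2 *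
          ((MarkovCoupling.couplingOperator ℝ P hP ^ n)
            (MarkovCoupling.BoundedMeasurable.one (S × S) ℝ)) (x₁, x₂) ∂μ))) atTop
      ≤ ENNReal.log (MarkovCoupling.couplingSpectralRadius P hP) := by

  have hn (n : ℕ) : (0 : EReal) ≤ ((1 / (n : ℝ) : ℝ) : EReal) :=
    EReal.coe_nonneg.2 (by positivity)
  refine ⟨limsup_le_limsup (Eventually.of_forall fun n ↦ ?_), ?_⟩
  · exact mul_le_mul_of_nonneg_left
      (ENNReal.log_monotone (MarkovCoupling.tvDist_pow_le P hP hμ x₁ n)) (hn n)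
  · rw [← (MarkovCoupling.tendsto_log_norm_couplingOperator_pow P hP).limsup_eq]
    refine limsup_le_limsup (Eventually.of_forall fun n ↦ ?_)
    exact mul_le_mul_of_nonneg_left
      (ENNReal.log_monotone (MarkovCoupling.ofReal_integral_le P hP μ x₁ n)) (hn n)
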